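/- Let $E$ be a complex Banach lattice, i.e. the complexification $E=E_{\mathbb R}\oplus iE_{\mathbb R}$ of a real Banach lattice $E_{\mathbb R}$, normed by $\|x+iy\|=\big\|\sup_{\theta\in\mathbb R}|x\cos\theta+y\sin\theta|\big\|$, with positive cone $E_+=\{x\in E_{\mathbb R}: x\ge 0\}$. A bounded linear operator $T$ on $E$ is called real if $TE_{\mathbb R}\subseteq E_{\mathbb R}$, positive if $TE_+\subseteq E_+$, and a lattice homomorphism if it is real and $T(x\vee y)=Tx\vee Ty$ for all $x,y\in E_{\mathbb R}$. Let $(Q_n)_{n\in\mathbb N}$ be a sequence of lattice homomorphisms on $E$ which is increasing (each $Q_{n+1}-Q_n$ is positive) and converges strongly to the identity ($Q_nf\to f$ in norm for every $f\in E$). Let $(e^{tA})_{t\ge 0}$ be a real $C_0$-semigroup on $E$ (each $e^{tA}$ is real) with generator $A$ and spectral bound $s(A):=\sup\{\operatorname{Re}\lambda:\lambda\in\sigma(A)\}>-\infty$ (where $\sup\emptyset=-\infty$). Suppose that the semigroup has the strong LEP (local eventual positivity) property with respect to $(Q_n)$: for every $n\in\mathbb N$ and every $f\in E_+\setminus\{0\}$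 there is $\tau>0$ such that for all $t\ge\tau$ one has $Q_ne^{tA}f\ge 0$ and $Q_ne^{tA}f$ is a quasi-interior point of the closed vector sublattice $F_n$ of $E_{\mathbb R}$ generated by $Q_nE_{\mathbb R}$. Here $u\in F_n$ with $u\ge0$ is a quasi-interior point of $F_n$ if the principal ideal $\{v\in F_n:|v|\le cu\text{ for some }c\ge0\}$ is dense in $F_n$. Then the following assertions are equivalent: (i) the limit $\lim_{t\to\infty}e^{tA}f$ exists in norm for every $f\in E$; (ii) for every $f\in E$ the orbit $\{e^{tA}f:t\ge0\}$ is relatively compact in the norm topology of $E$. -/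

import Mathlib

open Filter Topology
open scoped NNReal

/-! ### Complex Banach lattices

The real part is a real Banach lattice `E`; the complex Banach lattice is its complexification
`E ⊕ iE` with modulus `|x + iy| = sup_θ |cos θ • x + sin θ • y|` and norm `‖z‖ = ‖|z|‖`. -/

section Modulus

variable {E : Type*} [NormedAddCommGroup E] [NormedSpace ℝ E] [Lattice E] [IsOrderedAddMonoid E]
  [IsOrderedModule ℝ E]

theorem abs_smul_le_smul_abs (a : ℝ) (x : E) : |a • x| ≤ |a| • |x| := by
  have hx : (0 : E) ≤ |x| := abs_nonneg x
  have key : ∀ b : ℝ, b • x ≤ |b| • |x| := by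
    intro b
    rcases le_total 0 b with hb | hb
    · rw [abs_of_nonneg hb]
      exact smul_le_smul_of_nonneg_left (le_abs_self x) hb
    · rw [abs_of_nonpos hb]
      have h : (-b) • (-x) ≤ (-b) • |x| :=
        smul_le_smul_of_nonneg_left (neg_le_abs x) (neg_nonneg.2 hb)
      simpa using h
  refine sup_le (key a) ?_
  have h := key (-a)
  simpa using h

theorem abs_smul_of_nonneg_left {a : ℝ} (ha : 0 ≤ a) (x : E) : |a • x| = a • |x| := by
  apply le_antisymm
  · have h := abs_smul_le_smul_abs a x
    rwa [abs_of_nonneg ha] at h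
  · rcases ha.eq_or_lt with h0 | h0
    · simp [← h0]
    · have h := abs_smul_le_smul_abs a⁻¹ (a • x)
      rw [smul_smul, inv_mul_cancel₀ h0.ne', one_smul, abs_of_nonneg (inv_nonneg.2 ha)] at h
      have h2 := smul_le_smul_of_nonneg_left h ha
      rwa [smul_smul, mul_inv_cancel₀ h0.ne', one_smul] at h2

/-- `|Re (e^{-iθ} (x + iy))|`. -/
noncomputable def phaseAbs (x y : E) (θ : ℝ) : E := |Real.cos θ • x + Real.sin θ • y|

theorem phaseAbs_le_add (x y : E) {θ θ' ε : ℝ} (hc : |Real.cos θ - Real.cos θ'| ≤ ε)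
    (hs : |Real.sin θ - Real.sin θ'| ≤ ε) :
    phaseAbs x y θ ≤ phaseAbs x y θ' + ε • (|x| + |y|) := by
  have e : Real.cos θ • x + Real.sin θ • y = (Real.cos θ' • x + Real.sin θ' • y) +
      ((Real.cos θ - Real.cos θ') • x + (Real.sin θ - Real.sin θ') • y) := by
    module
  unfold phaseAbs
  rw [e]
  refine (abs_add_le _ _).trans ?_
  gcongr
  refine (abs_add_le _ _).trans ?_
  rw [smul_add]
  gcongr
  · exact (abs_smul_le_smul_abs _ _).trans (smul_le_smul_of_nonneg_right hc (abs_nonneg x))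
  · exact (abs_smul_le_smul_abs _ _).trans (smul_le_smul_of_nonneg_right hs (abs_nonneg y))

theorem exists_finset_phase {ε : ℝ} (hε : 0 < ε) : ∃ F : Finset ℝ, F.Nonempty ∧
    ∀ θ : ℝ, ∃ θ' ∈ F, |Real.cos θ - Real.cos θ'| ≤ ε ∧ |Real.sin θ - Real.sin θ'| ≤ ε := by
  classical
  have hcpt : IsCompact (Set.Icc (-Real.pi) Real.pi) := isCompact_Icc
  obtain ⟨t, -, htf, ht⟩ := Metric.finite_approx_of_totallyBounded hcpt.totallyBounded ε hε
  have main : ∀ θ : ℝ, ∃ θ' ∈ htf.toFinset, |Real.cos θ - Real.cos θ'| ≤ ε ∧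
      |Real.sin θ - Real.sin θ'| ≤ ε := by
    intro θ
    have hmem : toIocMod Real.two_pi_pos (-Real.pi) θ ∈ Set.Icc (-Real.pi) Real.pi := by
      have := toIocMod_mem_Ioc Real.two_pi_pos (-Real.pi) θ
      exact ⟨this.1.le, this.2.trans (by linarith)⟩
    obtain ⟨θ', h', hd⟩ : ∃ θ' ∈ t, dist (toIocMod Real.two_pi_pos (-Real.pi) θ) θ' < ε := by
      simpa using ht hmem
    set φ := toIocMod Real.two_pi_pos (-Real.pi) θ with hφ
    have hθ : θ = φ + toIocDiv Real.two_pi_pos (-Real.pi) θ * (2 * Real.pi) := by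
      have := toIocMod_add_toIocDiv_zsmul Real.two_pi_pos (-Real.pi) θ
      rw [zsmul_eq_mul] at this
      exact this.symm
    have hc : Real.cos θ = Real.cos φ := by
      rw [hθ]; exact Real.cos_add_int_mul_two_pi _ _
    have hs : Real.sin θ = Real.sin φ := by
      rw [hθ]; exact Real.sin_add_int_mul_two_pi _ _
    rw [Real.dist_eq] at hd
    refine ⟨θ', htf.mem_toFinset.2 h', ?_, ?_⟩
    · rw [hc]
      exact (Real.abs_cos_sub_cos_le _ _).trans hd.le
    · rw [hs]
      exact (Real.abs_sin_sub_sin_le _ _).trans hd.le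
  obtain ⟨θ', h', -⟩ := main 0
  exact ⟨htf.toFinset, ⟨θ', h'⟩, main⟩

variable [HasSolidNorm E] [CompleteSpace E]

/-- In a Banach lattice the supremum defining the modulus of `x + iy` exists. -/
theorem exists_isLUB_phaseAbs (x y : E) : ∃ m : E, IsLUB (Set.range (phaseAbs x y)) m := by
  have hpos : ∀ n : ℕ, (0 : ℝ) < 1 / ((n : ℝ) + 1) := fun n => Nat.one_div_pos_of_nat
  choose F hF hFa using fun n : ℕ => exists_finset_phase (hpos n)
  let s : ℕ → E := fun n => (F n).sup' (hF n) (phaseAbs x y)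
  have hu0 : (0 : E) ≤ |x| + |y| := add_nonneg (abs_nonneg x) (abs_nonneg y)
  have hs1 : ∀ n θ, phaseAbs x y θ ≤ s n + (1 / ((n : ℝ) + 1)) • (|x| + |y|) := by
    intro n θ
    obtain ⟨θ', h', hc, hs⟩ := hFa n θ
    refine (phaseAbs_le_add x y hc hs).trans ?_
    gcongr
    exact Finset.le_sup' (phaseAbs x y) h'
  have hs2 : ∀ m n, s m ≤ s n + (1 / ((n : ℝ) + 1)) • (|x| + |y|) := fun m n =>
    Finset.sup'_le _ _ fun θ _ => hs1 n θ
  have hdist : ∀ N m n : ℕ, N ≤ m → N ≤ n →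
      dist (s m) (s n) ≤ (1 / ((N : ℝ) + 1)) * ‖|x| + |y|‖ := by
    intro N m n hm hn
    have mono : ∀ k, N ≤ k →
        (1 / ((k : ℝ) + 1)) • (|x| + |y|) ≤ (1 / ((N : ℝ) + 1)) • (|x| + |y|) := fun k hk =>
      smul_le_smul_of_nonneg_right (Nat.one_div_le_one_div hk) hu0
    have habs : |s m - s n| ≤ |(1 / ((N : ℝ) + 1)) • (|x| + |y|)| := by
      refine le_trans ?_ (le_abs_self _)
      refine abs_le'.2 ⟨?_, ?_⟩
      · rw [sub_le_iff_le_add']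
        exact (hs2 m n).trans (add_le_add_right (mono n hn) _)
      · rw [neg_sub, sub_le_iff_le_add']
        exact (hs2 n m).trans (add_le_add_right (mono m hm) _)
    have := norm_le_norm_of_abs_le_abs habs
    rwa [norm_smul, Real.norm_of_nonneg (hpos N).le, ← dist_eq_norm] at this
  have hlim0 : Tendsto (fun N : ℕ => (1 / ((N : ℝ) + 1))) atTop (𝓝 0) :=
    tendsto_one_div_add_atTop_nhds_zero_nat
  have hcau : CauchySeq s :=
    cauchySeq_of_le_tendsto_0 (fun N : ℕ => (1 / ((N : ℝ) + 1)) * ‖|x| + |y|‖)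
      (fun m n N hm hn => hdist N m n hm hn) (by simpa using hlim0.mul_const ‖|x| + |y|‖)
  obtain ⟨l, hl⟩ := cauchySeq_tendsto_of_complete hcau
  refine ⟨l, ?_, ?_⟩
  · rintro _ ⟨θ, rfl⟩
    have h1 : Tendsto (fun n : ℕ => s n + (1 / ((n : ℝ) + 1)) • (|x| + |y|)) atTop (𝓝 l) := by
      simpa using hl.add (hlim0.smul_const (|x| + |y|))
    exact ge_of_tendsto' h1 fun n => hs1 n θ
  · intro b hb
    exact le_of_tendsto' hl fun n => Finset.sup'_le _ _ fun θ _ => hb ⟨θ, rfl⟩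

end Modulus

/-- The complexification `E ⊕ iE` of a real vector space `E`. -/
@[ext]
structure Complexification (E : Type*) where
  re : E
  im : E

namespace Complexification

section AddGroup

variable {E : Type*} [AddCommGroup E]

instance : Zero (Complexification E) := ⟨⟨0, 0⟩⟩
instance : Add (Complexification E) := ⟨fun z w => ⟨z.re + w.re, z.im + w.im⟩⟩
instance : Neg (Complexification E) := ⟨fun z => ⟨-z.re, -z.im⟩⟩
instance : Sub (Complexification E) := ⟨fun z w => ⟨z.re - w.re, z.im - w.im⟩⟩

@[simp] theorem zero_re : (0 : Complexification E).re = 0 := rfl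
@[simp] theorem zero_im : (0 : Complexification E).im = 0 := rfl
@[simp] theorem add_re (z w : Complexification E) : (z + w).re = z.re + w.re := rfl
@[simp] theorem add_im (z w : Complexification E) : (z + w).im = z.im + w.im := rfl
@[simp] theorem neg_re (z : Complexification E) : (-z).re = -z.re := rfl
@[simp] theorem neg_im (z : Complexification E) : (-z).im = -z.im := rfl
@[simp] theorem sub_re (z w : Complexification E) : (z - w).re = z.re - w.re := rfl
@[simp] theorem sub_im (z w : Complexification E) : (z - w).im = z.im - w.im := rfl

instance : AddCommGroup (Complexification E) where
  add_assoc a b c := by ext <;> simp [add_assoc]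
  zero_add a := by ext <;> simp
  add_zero a := by ext <;> simp
  add_comm a b := by ext <;> simp [add_comm]
  neg_add_cancel a := by ext <;> simp
  sub_eq_add_neg a b := by ext <;> simp [sub_eq_add_neg]
  nsmul := nsmulRec
  zsmul := zsmulRec

end AddGroup

section Module

variable {E : Type*} [AddCommGroup E] [Module ℝ E]

instance : SMul ℂ (Complexification E) :=
  ⟨fun c z => ⟨c.re • z.re - c.im • z.im, c.re • z.im + c.im • z.re⟩⟩

@[simp] theorem smul_re (c : ℂ) (z : Complexification E) :
    (c • z).re = c.re • z.re - c.im • z.im := rfl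
@[simp] theorem smul_im (c : ℂ) (z : Complexification E) :
    (c • z).im = c.re • z.im + c.im • z.re := rfl

instance : Module ℂ (Complexification E) where
  one_smul z := by ext <;> simp
  mul_smul a b z := by ext <;> simp <;> module
  smul_zero a := by ext <;> simp
  smul_add a z w := by ext <;> simp <;> module
  add_smul a b z := by ext <;> simp <;> module
  zero_smul z := by ext <;> simp

end Module

theorem norm_le_of_nonneg_of_le {E : Type*} [NormedAddCommGroup E] [Lattice E]
    [IsOrderedAddMonoid E] [HasSolidNorm E] {a b : E} (ha : 0 ≤ a) (hab : a ≤ b) : ‖a‖ ≤ ‖b‖ :=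
  norm_le_norm_of_abs_le_abs (by rwa [abs_of_nonneg ha, abs_of_nonneg (ha.trans hab)])

variable {E : Type*} [NormedAddCommGroup E] [NormedSpace ℝ E] [Lattice E] [IsOrderedAddMonoid E]
  [IsOrderedModule ℝ E] [HasSolidNorm E] [CompleteSpace E]

/-- The modulus `|x + iy| = sup_θ |cos θ • x + sin θ • y|`. -/
noncomputable def modulus (z : Complexification E) : E :=
  (exists_isLUB_phaseAbs z.re z.im).choose

theorem isLUB_modulus (z : Complexification E) :
    IsLUB (Set.range fun θ : ℝ => |Real.cos θ • z.re + Real.sin θ • z.im|) z.modulus :=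
  (exists_isLUB_phaseAbs z.re z.im).choose_spec

theorem le_modulus (z : Complexification E) (θ : ℝ) :
    |Real.cos θ • z.re + Real.sin θ • z.im| ≤ z.modulus :=
  z.isLUB_modulus.1 ⟨θ, rfl⟩

theorem modulus_le {z : Complexification E} {b : E}
    (h : ∀ θ : ℝ, |Real.cos θ • z.re + Real.sin θ • z.im| ≤ b) : z.modulus ≤ b :=
  z.isLUB_modulus.2 (by rintro _ ⟨θ, rfl⟩; exact h θ)

theorem modulus_nonneg (z : Complexification E) : 0 ≤ z.modulus :=
  (abs_nonneg _).trans (z.le_modulus 0)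

theorem abs_re_le_modulus (z : Complexification E) : |z.re| ≤ z.modulus := by
  simpa using z.le_modulus 0

theorem abs_im_le_modulus (z : Complexification E) : |z.im| ≤ z.modulus := by
  simpa using z.le_modulus (Real.pi / 2)

theorem modulus_add_le (z w : Complexification E) : (z + w).modulus ≤ z.modulus + w.modulus := by
  refine modulus_le fun θ => ?_
  have e : Real.cos θ • (z + w).re + Real.sin θ • (z + w).im =
      (Real.cos θ • z.re + Real.sin θ • z.im) + (Real.cos θ • w.re + Real.sin θ • w.im) := by
    simp only [add_re, add_im]; module
  rw [e]
  exact (abs_add_le _ _).trans (add_le_add (z.le_modulus θ) (w.le_modulus θ))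

theorem modulus_smul_le (c : ℂ) (z : Complexification E) :
    (c • z).modulus ≤ ‖c‖ • z.modulus := by
  refine modulus_le fun θ => ?_
  have hre : c.re = ‖c‖ * Real.cos c.arg := (Complex.norm_mul_cos_arg c).symm
  have him : c.im = ‖c‖ * Real.sin c.arg := (Complex.norm_mul_sin_arg c).symm
  have e : Real.cos θ • (c • z).re + Real.sin θ • (c • z).im =
      ‖c‖ • (Real.cos (θ - c.arg) • z.re + Real.sin (θ - c.arg) • z.im) := by
    simp only [smul_re, smul_im, Real.cos_sub, Real.sin_sub]
    rw [hre, him]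
    module
  rw [e, abs_smul_of_nonneg_left (norm_nonneg c)]
  exact smul_le_smul_of_nonneg_left (z.le_modulus _) (norm_nonneg c)

/-- The norm `‖z‖ = ‖|z|‖`. -/
noncomputable instance : Norm (Complexification E) := ⟨fun z => ‖z.modulus‖⟩

theorem norm_def (z : Complexification E) : ‖z‖ = ‖z.modulus‖ := rfl

theorem norm_re_le (z : Complexification E) : ‖z.re‖ ≤ ‖z‖ :=
  norm_le_norm_of_abs_le_abs (z.abs_re_le_modulus.trans (le_abs_self _))

theorem norm_im_le (z : Complexification E) : ‖z.im‖ ≤ ‖z‖ :=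
  norm_le_norm_of_abs_le_abs (z.abs_im_le_modulus.trans (le_abs_self _))

theorem norm_smul_le_aux (c : ℂ) (z : Complexification E) : ‖c • z‖ ≤ ‖c‖ * ‖z‖ := by
  have h := norm_le_of_nonneg_of_le (modulus_nonneg (c • z)) (modulus_smul_le c z)
  rwa [norm_smul, norm_norm] at h

theorem modulus_zero : (0 : Complexification E).modulus = 0 :=
  le_antisymm (modulus_le fun θ => by simp) (modulus_nonneg _)

theorem normedSpaceCore : NormedSpace.Core ℂ (Complexification E) where
  norm_nonneg z := norm_nonneg z.modulus
  norm_smul c z := by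
    refine le_antisymm (norm_smul_le_aux c z) ?_
    rcases eq_or_ne c 0 with rfl | hc
    · rw [norm_zero, zero_mul]
      exact norm_nonneg ((0 : ℂ) • z).modulus
    · have h := norm_smul_le_aux c⁻¹ (c • z)
      rw [smul_smul, inv_mul_cancel₀ hc, one_smul, norm_inv] at h
      calc ‖c‖ * ‖z‖ ≤ ‖c‖ * (‖c‖⁻¹ * ‖c • z‖) := by gcongr
        _ = ‖c • z‖ := by rw [← mul_assoc, mul_inv_cancel₀ (norm_ne_zero_iff.2 hc), one_mul]
  norm_triangle z w :=
    (norm_le_of_nonneg_of_le (modulus_nonneg _) (modulus_add_le z w)).trans (norm_add_le _ _)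
  norm_eq_zero_iff z := by
    constructor
    · intro h
      have h1 := norm_re_le z
      have h2 := norm_im_le z
      rw [h] at h1 h2
      ext
      · simpa using h1
      · simpa using h2
    · rintro rfl
      rw [norm_def, modulus_zero, norm_zero]

noncomputable instance : NormedAddCommGroup (Complexification E) :=
  NormedAddCommGroup.ofCore normedSpaceCore

noncomputable instance : NormedSpace ℂ (Complexification E) :=
  NormedSpace.ofCore normedSpaceCore

theorem norm_le_add (z : Complexification E) : ‖z‖ ≤ ‖z.re‖ + ‖z.im‖ := by
  have h : z.modulus ≤ |z.re| + |z.im| := by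
    refine modulus_le fun θ => (abs_add_le _ _).trans (add_le_add ?_ ?_)
    · refine (abs_smul_le_smul_abs _ _).trans ?_
      simpa using smul_le_smul_of_nonneg_right (Real.abs_cos_le_one θ) (abs_nonneg z.re)
    · refine (abs_smul_le_smul_abs _ _).trans ?_
      simpa using smul_le_smul_of_nonneg_right (Real.abs_sin_le_one θ) (abs_nonneg z.im)
  refine (norm_le_of_nonneg_of_le z.modulus_nonneg h).trans ((norm_add_le _ _).trans ?_)
  rw [norm_abs_eq_norm, norm_abs_eq_norm]

theorem dist_re_le (z w : Complexification E) : dist z.re w.re ≤ dist z w := by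
  rw [dist_eq_norm z.re w.re, dist_eq_norm z w]
  exact norm_re_le (z - w)

theorem dist_im_le (z w : Complexification E) : dist z.im w.im ≤ dist z w := by
  rw [dist_eq_norm z.im w.im, dist_eq_norm z w]
  exact norm_im_le (z - w)

theorem dist_le_add (z w : Complexification E) :
    dist z w ≤ dist z.re w.re + dist z.im w.im := by
  rw [dist_eq_norm z.re w.re, dist_eq_norm z.im w.im, dist_eq_norm z w]
  exact norm_le_add (z - w)

instance : CompleteSpace (Complexification E) := by
  refine Metric.complete_of_cauchySeq_tendsto fun u hu => ?_
  have hre : CauchySeq fun n => (u n).re := by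
    refine Metric.cauchySeq_iff.2 fun ε hε => ?_
    obtain ⟨N, hN⟩ := Metric.cauchySeq_iff.1 hu ε hε
    exact ⟨N, fun m hm n hn => (dist_re_le (u m) (u n)).trans_lt (hN m hm n hn)⟩
  have him : CauchySeq fun n => (u n).im := by
    refine Metric.cauchySeq_iff.2 fun ε hε => ?_
    obtain ⟨N, hN⟩ := Metric.cauchySeq_iff.1 hu ε hε
    exact ⟨N, fun m hm n hn => (dist_im_le (u m) (u n)).trans_lt (hN m hm n hn)⟩
  obtain ⟨a, ha⟩ := cauchySeq_tendsto_of_complete hre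
  obtain ⟨b, hb⟩ := cauchySeq_tendsto_of_complete him
  refine ⟨⟨a, b⟩, tendsto_iff_dist_tendsto_zero.2 ?_⟩
  have hab := (tendsto_iff_dist_tendsto_zero.1 ha).add (tendsto_iff_dist_tendsto_zero.1 hb)
  rw [add_zero] at hab
  exact squeeze_zero (fun n => dist_nonneg) (fun n => dist_le_add (u n) ⟨a, b⟩) hab

/-- The embedding of the real part. -/
def ofReal (x : E) : Complexification E := ⟨x, 0⟩

end Complexification

/-! ### Positive operators, lattice homomorphisms, quasi-interior points -/

section Order

variable {E : Type*} [NormedAddCommGroup E] [NormedSpace ℝ E] [Lattice E] [IsOrderedAddMonoid E]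
  [IsOrderedModule ℝ E] [HasSolidNorm E] [CompleteSpace E]

/-- The positive cone `E₊` of the complex Banach lattice: the real elements that are `≥ 0`. -/
def positiveCone (E : Type*) [NormedAddCommGroup E] [Lattice E] : Set (Complexification E) :=
  {z | z.im = 0 ∧ 0 ≤ z.re}

/-- `T` is positive: `T E₊ ⊆ E₊`. -/
def IsPositiveOperator (T : Complexification E →L[ℂ] Complexification E) : Prop :=
  ∀ f ∈ positiveCone E, T f ∈ positiveCone E

/-- `T` is real: it maps the real part into itself. -/
def IsRealOperator (T : Complexification E →L[ℂ] Complexification E) : Prop :=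
  ∀ x : E, (T (Complexification.ofReal x)).im = 0

/-- `T` is a lattice homomorphism: it is real and preserves suprema in the real part. -/
def IsLatticeHomomorphism (T : Complexification E →L[ℂ] Complexification E) : Prop :=
  IsRealOperator T ∧ ∀ x y : E, (T (Complexification.ofReal (x ⊔ y))).re =
    (T (Complexification.ofReal x)).re ⊔ (T (Complexification.ofReal y)).re

/-- The sequence increases in the operator order: `P n ≤ P (n + 1)` for all `n`. -/
def IsIncreasingSeq (P : ℕ → Complexification E →L[ℂ] Complexification E) : Prop :=
  ∀ n, IsPositiveOperator (P (n + 1) - P n)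

/-- The sequence converges strongly (pointwise in norm) to the identity. -/
def ConvergesStronglyToId (P : ℕ → Complexification E →L[ℂ] Complexification E) : Prop :=
  ∀ f, Tendsto (fun n => P n f) atTop (𝓝 f)

/-- The closed (vector) sublattice of `E` generated by `S`: the intersection of all closed linear
subspaces of `E` that contain `S` and are stable under `⊔` and `⊓`. -/
def closedSublatticeSpan (S : Set E) : Submodule ℝ E :=
  sInf {F : Submodule ℝ E | IsClosed (F : Set E) ∧ S ⊆ F ∧
    ∀ x ∈ F, ∀ y ∈ F, x ⊔ y ∈ F ∧ x ⊓ y ∈ F}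

/-- `u` is a quasi-interior point of the vector sublattice `F`: `u ∈ F₊`, and the principal ideal
`{v ∈ F | ∃ c, |v| ≤ c u}` that `u` generates in `F` is dense in `F`. -/
def IsQuasiInteriorPoint (F : Submodule ℝ E) (u : E) : Prop :=
  u ∈ F ∧ 0 ≤ u ∧ (F : Set E) ⊆ closure {v : E | v ∈ F ∧ ∃ c : ℝ, |v| ≤ c • u}

/-- The real part of the range of a real operator `P`, as a subset of the real part `E`. -/
def realRange (P : Complexification E →L[ℂ] Complexification E) : Set E :=
  Set.range fun x : E => (P (Complexification.ofReal x)).re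

end Order

/-! ### `C₀`-semigroups, generator, spectral bound -/

/-- A `C₀`-semigroup of bounded linear operators on `X`. -/
structure C0Semigroup (X : Type*) [NormedAddCommGroup X] [NormedSpace ℂ X] where
  toFun : ℝ≥0 → X →L[ℂ] X
  map_zero' : toFun 0 = ContinuousLinearMap.id ℂ X
  map_add' : ∀ s t, toFun (s + t) = (toFun s).comp (toFun t)
  continuous_orbit' : ∀ x, Continuous fun t => toFun t x

section Spectrum

variable {X : Type*} [NormedAddCommGroup X] [NormedSpace ℂ X]

namespace C0Semigroup

instance : CoeFun (C0Semigroup X) fun _ => ℝ≥0 → X →L[ℂ] X := ⟨C0Semigroup.toFun⟩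

/-- `y` is the limit of `(T t x - x) / t` as `t ↓ 0`, that is, `x ∈ D(A)` and `A x = y`. -/
def HasGenValue (T : C0Semigroup X) (x y : X) : Prop :=
  Tendsto (fun t : ℝ≥0 => ((t : ℂ)⁻¹) • (T t x - x)) (𝓝[>] 0) (𝓝 y)

theorem HasGenValue.add {T : C0Semigroup X} {x y x' y' : X} (h : T.HasGenValue x y)
    (h' : T.HasGenValue x' y') : T.HasGenValue (x + x') (y + y') := by
  refine (Tendsto.add h h').congr fun t => ?_
  rw [map_add]; module

theorem HasGenValue.smul {T : C0Semigroup X} {x y : X} (c : ℂ) (h : T.HasGenValue x y) :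
    T.HasGenValue (c • x) (c • y) := by
  refine (Tendsto.const_smul h c).congr fun t => ?_
  rw [map_smul]; module

theorem HasGenValue.unique {T : C0Semigroup X} {x y y' : X} (h : T.HasGenValue x y)
    (h' : T.HasGenValue x y') : y = y' :=
  tendsto_nhds_unique h h'

/-- The generator `A` of the semigroup, with domain `{x | lim_{t ↓ 0} (T t x - x) / t exists}`. -/
noncomputable def generator (T : C0Semigroup X) : X →ₗ.[ℂ] X where
  domain :=
    { carrier := {x | ∃ y, T.HasGenValue x y}
      add_mem' := fun ⟨_, h⟩ ⟨_, h'⟩ => ⟨_, h.add h'⟩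
      zero_mem' := ⟨0, by simp [HasGenValue]⟩
      smul_mem' := fun c _ ⟨_, h⟩ => ⟨_, h.smul c⟩ }
  toFun :=
    { toFun := fun x => x.2.choose
      map_add' := fun x x' =>
        (x + x').2.choose_spec.unique (x.2.choose_spec.add x'.2.choose_spec)
      map_smul' := fun c x => (c • x).2.choose_spec.unique (x.2.choose_spec.smul c) }

end C0Semigroup

/-- `λ` lies in the resolvent set of `A` if `λ - A : D(A) → X` has a bounded two-sided inverse. -/
def IsInResolventSet (A : X →ₗ.[ℂ] X) (l : ℂ) : Prop :=
  ∃ R : X →L[ℂ] X, (∀ x : A.domain, R (l • (x : X) - A x) = x) ∧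
    ∀ y : X, ∃ x : A.domain, (x : X) = R y ∧ l • (x : X) - A x = y

/-- The spectrum of a (possibly unbounded) operator. -/
def operatorSpectrum (A : X →ₗ.[ℂ] X) : Set ℂ := {l | ¬ IsInResolventSet A l}

/-- The spectral bound `s(A) = sup {Re λ | λ ∈ σ(A)} ∈ [-∞, ∞]`, equal to `-∞` if `σ(A) = ∅`. -/
noncomputable def spectralBound (A : X →ₗ.[ℂ] X) : EReal :=
  sSup ((fun l : ℂ => (l.re : EReal)) '' operatorSpectrum A)

end Spectrum

/-! ### Strong local eventual positivity -/

section LEP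

variable {E : Type*} [NormedAddCommGroup E] [NormedSpace ℝ E] [Lattice E] [IsOrderedAddMonoid E]
  [IsOrderedModule ℝ E] [HasSolidNorm E] [CompleteSpace E]

/-- The semigroup is real: every `T t` maps the real part into itself. -/
def C0Semigroup.IsReal (T : C0Semigroup (Complexification E)) : Prop :=
  ∀ t, IsRealOperator (T t)

/-- The strong LEP property with respect to `P`: for all `n` and `f ∈ E₊ \ {0}` there is `τ > 0`
such that for all `t ≥ τ`, `P n (T t f) ≥ 0` and `P n (T t f)` is a quasi-interior point of the
closed sublattice generated by the range of `P n`. -/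
def C0Semigroup.HasStrongLEP (T : C0Semigroup (Complexification E))
    (P : ℕ → Complexification E →L[ℂ] Complexification E) : Prop :=
  ∀ n : ℕ, ∀ f ∈ positiveCone E, f ≠ 0 → ∃ τ : ℝ≥0, 0 < τ ∧ ∀ t : ℝ≥0, τ ≤ t →
    P n (T t f) ∈ positiveCone E ∧
      IsQuasiInteriorPoint (closedSublatticeSpan (realRange (P n))) (P n (T t f)).re

end LEP

/-! A convergent continuous orbit is relatively compact, so the content is the converse, which is
reduced to the real part `E`, where `U t` denotes the semigroup and `q n` the restricted
homomorphisms. Relative compactness makes the strong limit points of `U t` at infinity a compact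
semigroup, which contains an idempotent `P` (`exists_idempotent_strongLimitPoint`), as in the
Jacobs–de Leeuw–Glicksberg splitting. Orbits in the kernel of `P` tend to `0`; on the range of `P`
each `U t` is invertible, with inverse given by a limit point. Local eventual positivity makes all
limit points positive (`strongLimitPoint_nonneg`), so `U t` acts on the range of `P` as a lattice
isomorphism for the lattice structure with positive part `P x⁺` (`map_posPart_of_fixed`). If `x = P
x` had no sign, `P x⁺` and `P x⁻` would be nonzero and disjoint in that structure, and so would
their images under `U t`. Yet for large `t` the operator `q n` sends both images to quasi-interior
points of `F n`, which forces `P` to vanish on `q n x⁺` for all `n`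
(`map_eq_zero_of_isQuasiInteriorPoint`), hence on `x⁺`. So the range of `P` is totally ordered. Then
`U t x - x` has a sign for each fixed point `x` of `P`, the orbit along multiples of `t` is
monotone, and compactness forces `U t x = x` (`eq_of_le_of_isCompact_orbit`). Therefore `U t x`
converges to `P x` for every `x`. -/

set_option linter.unusedSectionVars false

/-! ### Strong limit points of a bounded semigroup at infinity -/

section LimitPoints

variable {E : Type*} [NormedAddCommGroup E] [NormedSpace ℝ E]

/-- The cluster points of `U t` as `t → ∞` for the topology of pointwise convergence. -/
def strongLimitPoints (U : ℝ≥0 → E →L[ℝ] E) : Set (E → E) :=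
  {S | MapClusterPt S atTop fun t x => U t x}

variable {U : ℝ≥0 → E →L[ℝ] E}

theorem mem_strongLimitPoints_iff {S : E → E} : S ∈ strongLimitPoints U ↔
    ∃ l : Ultrafilter ℝ≥0, ↑l ≤ (atTop : Filter ℝ≥0) ∧
      ∀ x, Tendsto (fun t => U t x) l (𝓝 (S x)) := by
  simp only [strongLimitPoints, Set.mem_ofPred_eq, mapClusterPt_iff_ultrafilter, tendsto_pi_nhds]

theorem mem_strongLimitPoints_of_tendsto {ι : Type*} {l : Filter ι} [l.NeBot] {S : E → E}
    {φ : ι → ℝ≥0} (hφ : Tendsto φ l atTop) (h : ∀ x, Tendsto (fun i => U (φ i) x) l (𝓝 (S x))) :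
    S ∈ strongLimitPoints U := by
  have h' : Tendsto (fun i x => U (φ i) x) l (𝓝 S) := tendsto_pi_nhds.2 h
  exact MapClusterPt.of_comp hφ h'.mapClusterPt

theorem isClosed_strongLimitPoints : IsClosed (strongLimitPoints U) :=
  isClosed_setOfPred_clusterPt

theorem exists_norm_le_of_isCompact_orbit [CompleteSpace E]
    (hcomp : ∀ x, IsCompact (closure (Set.range fun t => U t x))) :
    ∃ M : ℝ, 0 < M ∧ ∀ t x, ‖U t x‖ ≤ M * ‖x‖ := by
  obtain ⟨C, hC⟩ := banach_steinhaus (g := U) fun x => by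
    obtain ⟨C, hC⟩ := (hcomp x).isBounded.exists_norm_le
    exact ⟨C, fun t => hC _ (subset_closure ⟨t, rfl⟩)⟩
  -- The maximum with `1` keeps the bound positive, so that it can be divided by later.
  refine ⟨max C 1, lt_max_of_lt_right one_pos, fun t x => ?_⟩
  exact (U t).le_of_opNorm_le ((hC t).trans (le_max_left _ _)) x

theorem exists_continuousLinearMap_eq {M : ℝ} (hM : ∀ t x, ‖U t x‖ ≤ M * ‖x‖) {S : E → E}
    (hS : S ∈ strongLimitPoints U) : ∃ L : E →L[ℝ] E, S = L := by
  obtain ⟨l, -, hl⟩ := mem_strongLimitPoints_iff.1 hS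
  let L : E →ₗ[ℝ] E :=
    { toFun := S
      map_add' := fun x y => tendsto_nhds_unique (hl (x + y)) <| by
        simpa only [map_add] using (hl x).add (hl y)
      map_smul' := fun c x => tendsto_nhds_unique (hl (c • x)) <| by
        simpa only [map_smul, RingHom.id_apply] using (hl x).const_smul c }
  exact ⟨L.mkContinuous M fun x => le_of_tendsto (hl x).norm (.of_forall fun t => hM t x), rfl⟩

theorem isCompact_strongLimitPoints
    (hcomp : ∀ x, IsCompact (closure (Set.range fun t => U t x))) :
    IsCompact (strongLimitPoints U) := by
  refine (isCompact_univ_pi hcomp).of_isClosed_subset isClosed_strongLimitPoints fun S hS x _ => ?_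
  obtain ⟨l, -, hl⟩ := mem_strongLimitPoints_iff.1 hS
  exact mem_closure_of_tendsto (hl x) (.of_forall fun t => ⟨t, rfl⟩)

/-- Along an ultrafilter at infinity, time-shifted orbits of a relatively compact family
converge. -/
theorem exists_mem_strongLimitPoints
    (hcomp : ∀ x, IsCompact (closure (Set.range fun t => U t x))) (l : Ultrafilter ℝ≥0)
    {φ : ℝ≥0 → ℝ≥0} (hφ : Tendsto φ l atTop) :
    ∃ S ∈ strongLimitPoints U, ∀ x, Tendsto (fun t => U (φ t) x) l (𝓝 (S x)) := by
  have h : ∀ x, ∃ y, Tendsto (fun t => U (φ t) x) l (𝓝 y) := fun x => by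
    obtain ⟨y, -, hy⟩ := (hcomp x).ultrafilter_le_nhds (l.map fun t => U (φ t) x) <| by
      rw [le_principal_iff, Ultrafilter.mem_coe, Ultrafilter.mem_map]
      exact Filter.univ_mem' fun t => subset_closure ⟨φ t, rfl⟩
    exact ⟨y, hy⟩
  choose S hS using h
  exact ⟨S, mem_strongLimitPoints_of_tendsto hφ hS, hS⟩

/-- The limits are taken one at a time: each `U t ∘ R` is a limit point along shifted times, and `S
∘ R` is a pointwise limit of these, so closedness suffices. -/
theorem strongLimitPoints_comp_mem (hadd : ∀ s t x, U (s + t) x = U s (U t x)) {S R : E → E}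
    (hS : S ∈ strongLimitPoints U) (hR : R ∈ strongLimitPoints U) :
    S ∘ R ∈ strongLimitPoints U := by
  obtain ⟨l, -, hl⟩ := mem_strongLimitPoints_iff.1 hS
  obtain ⟨l', hl', hR⟩ := mem_strongLimitPoints_iff.1 hR
  have h : ∀ t, (fun x => U t (R x)) ∈ strongLimitPoints U := fun t => by
    refine mem_strongLimitPoints_of_tendsto (l := (l' : Filter ℝ≥0)) (φ := fun s => t + s)
      (tendsto_atTop_mono (fun _ => le_add_self) (tendsto_id'.2 hl')) fun x => ?_
    simp only [hadd]
    exact ((U t).continuous.tendsto _).comp (hR x)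
  have h' : Tendsto (fun t x => U t (R x)) l (𝓝 (S ∘ R)) := tendsto_pi_nhds.2 fun x => hl (R x)
  exact isClosed_strongLimitPoints.mem_of_tendsto h' (.of_forall h)

/-- This is the Ellis–Numakura lemma. It needs only continuity of `S ↦ S ∘ R` for fixed `R`, which
holds in the product topology even for discontinuous `R`. -/
theorem exists_idempotent_strongLimitPoint (hadd : ∀ s t x, U (s + t) x = U s (U t x))
    (hcomp : ∀ x, IsCompact (closure (Set.range fun t => U t x))) :
    ∃ P ∈ strongLimitPoints U, P ∘ P = P := by
  let _ : Semigroup (E → E) := { mul := fun S R => S ∘ R, mul_assoc := fun _ _ _ => rfl }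
  obtain ⟨l, hl⟩ := exists_ultrafilter_iff.2 (inferInstance : (atTop : Filter ℝ≥0).NeBot)
  obtain ⟨S, hS, -⟩ := exists_mem_strongLimitPoints hcomp l (tendsto_id'.2 hl)
  exact exists_idempotent_in_compact_subsemigroup (M := E → E)
    (fun R => continuous_pi fun x => continuous_apply (R x)) _ ⟨S, hS⟩
    (isCompact_strongLimitPoints hcomp) fun S hS R hR => strongLimitPoints_comp_mem hadd hS hR

theorem strongLimitPoint_comm (hadd : ∀ s t x, U (s + t) x = U s (U t x)) {S : E → E}
    (hS : S ∈ strongLimitPoints U) (t : ℝ≥0) (x : E) : S (U t x) = U t (S x) := by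
  obtain ⟨l, -, hl⟩ := mem_strongLimitPoints_iff.1 hS
  refine tendsto_nhds_unique (hl (U t x)) ?_
  refine (((U t).continuous.tendsto _).comp (hl x)).congr fun s => ?_
  simp only [Function.comp, ← hadd, add_comm]

/-- `U t` divides every strong limit point. -/
theorem exists_strongLimitPoint_comp_eq (hadd : ∀ s t x, U (s + t) x = U s (U t x))
    (hcomp : ∀ x, IsCompact (closure (Set.range fun t => U t x))) {S : E → E}
    (hS : S ∈ strongLimitPoints U) (t : ℝ≥0) :
    ∃ R ∈ strongLimitPoints U, ∀ x, R (U t x) = S x := by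
  obtain ⟨l, hle, hl⟩ := mem_strongLimitPoints_iff.1 hS
  -- `R` is the limit of `U (s - t)`; truncation of the subtraction is harmless because eventually
  -- `s ≥ t`.
  obtain ⟨R, hR, hRl⟩ := exists_mem_strongLimitPoints hcomp l (φ := fun s => s - t)
    ((tendsto_atTop.2 fun b => (eventually_ge_atTop (b + t)).mono fun s hs =>
      le_tsub_of_add_le_right hs).mono_left hle)
  refine ⟨R, hR, fun x => tendsto_nhds_unique (hRl (U t x)) ((hl x).congr' ?_)⟩
  filter_upwards [hle (eventually_ge_atTop t)] with s hs
  rw [← hadd, tsub_add_cancel_of_le hs]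

/-- By uniform boundedness, an orbit that is small at one time stays small afterwards. -/
theorem tendsto_zero_of_frequently (hadd : ∀ s t x, U (s + t) x = U s (U t x)) {M : ℝ}
    (hM0 : 0 < M) (hM : ∀ t x, ‖U t x‖ ≤ M * ‖x‖) {x : E} {ι : Type*} {l : Filter ι} [l.NeBot]
    {φ : ι → ℝ≥0} (h : Tendsto (fun i => U (φ i) x) l (𝓝 0)) :
    Tendsto (fun t => U t x) atTop (𝓝 0) := by
  refine Metric.tendsto_nhds.2 fun ε hε => ?_
  obtain ⟨i, hi⟩ := (Metric.tendsto_nhds.1 h (ε / M) (by positivity)).exists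
  rw [dist_zero_right, lt_div_iff₀' hM0] at hi
  filter_upwards [eventually_ge_atTop (φ i)] with t ht
  rw [dist_zero_right, ← tsub_add_cancel_of_le ht, hadd]
  exact (hM _ _).trans_lt hi

end LimitPoints

/-! ### Convergence of real semigroups on Banach lattices -/

section Lattice

variable {E : Type*} [NormedAddCommGroup E] [NormedSpace ℝ E] [Lattice E] [IsOrderedAddMonoid E]
  [IsOrderedModule ℝ E] [HasSolidNorm E]

/-- A positive operator that vanishes at the infimum of two quasi-interior points of `F` vanishes
on the positive elements of `F`. -/
theorem map_eq_zero_of_isQuasiInteriorPoint {F : Submodule ℝ E} {a b : E}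
    (ha : IsQuasiInteriorPoint F a) (hb : IsQuasiInteriorPoint F b) (P : E →L[ℝ] E)
    (hP : ∀ x, 0 ≤ x → 0 ≤ P x) (hPab : P (a ⊓ b) = 0) {y : E} (hy : y ∈ F) (hy0 : 0 ≤ y) :
    P y = 0 := by
  have hclosed : IsClosed {p : E × E | P (y ⊓ (|p.1| ⊓ |p.2|)) = 0} :=
    isClosed_eq (by unfold abs; fun_prop) continuous_const
  have hsub : {v : E | v ∈ F ∧ ∃ c : ℝ, |v| ≤ c • a} ×ˢ {v : E | v ∈ F ∧ ∃ c : ℝ, |v| ≤ c • b} ⊆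
      {p : E × E | P (y ⊓ (|p.1| ⊓ |p.2|)) = 0} := by
    rintro ⟨v, w⟩ ⟨⟨-, c, hv⟩, -, d, hw⟩
    simp only [Set.mem_ofPred_eq] at hv hw ⊢
    -- One constant serves both bounds; the `1` makes it invertible, since `c` and `d` may fail to
    -- be positive.
    set C := max (max c d) 1
    have hC : 0 < C := lt_max_of_lt_right one_pos
    have h1 : |v| ≤ C • a := hv.trans <|
      smul_le_smul_of_nonneg_right ((le_max_left c d).trans (le_max_left _ _)) ha.2.1
    have h2 : |w| ≤ C • b := hw.trans <|
      smul_le_smul_of_nonneg_right ((le_max_right c d).trans (le_max_left _ _)) hb.2.1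
    have hle : y ⊓ (|v| ⊓ |w|) ≤ C • (a ⊓ b) := by
      rw [← inv_smul_le_iff_of_pos hC]
      refine le_inf ?_ ?_ <;> rw [inv_smul_le_iff_of_pos hC]
      · exact (inf_le_right.trans inf_le_left).trans h1
      · exact (inf_le_right.trans inf_le_right).trans h2
    refine le_antisymm ?_ (hP _ (le_inf hy0 (le_inf (abs_nonneg v) (abs_nonneg w))))
    have := hP _ (sub_nonneg.2 hle)
    rwa [map_sub, map_smul, hPab, smul_zero, sub_nonneg] at this
  have hmem : ((y, y) : E × E) ∈ closure ({v : E | v ∈ F ∧ ∃ c : ℝ, |v| ≤ c • a} ×ˢ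
      {v : E | v ∈ F ∧ ∃ c : ℝ, |v| ≤ c • b}) := by
    rw [closure_prod_eq]
    exact ⟨ha.2.2 hy, hb.2.2 hy⟩
  -- At the pair `(y, y)` the closed condition reads `P y = 0`.
  simpa [abs_of_nonneg hy0] using closure_minimal hsub hclosed hmem

variable {U : ℝ≥0 → E →L[ℝ] E} {q : ℕ → E →L[ℝ] E}

/-- For fixed `n` the time `t` goes to infinity, giving `0 ≤ q n (S f)`; only then does `n`. The
threshold `τ` may thus depend on `n`. -/
theorem strongLimitPoint_nonneg (hqid : ∀ x, Tendsto (fun n => q n x) atTop (𝓝 x))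
    (hpos : ∀ n f, 0 ≤ f → ∃ τ : ℝ≥0, ∀ t, τ ≤ t → 0 ≤ q n (U t f)) {S : E → E}
    (hS : S ∈ strongLimitPoints U) {f : E} (hf : 0 ≤ f) : 0 ≤ S f := by
  obtain ⟨l, hle, hl⟩ := mem_strongLimitPoints_iff.1 hS
  refine ge_of_tendsto' (hqid (S f)) fun n => ?_
  obtain ⟨τ, hτ⟩ := hpos n f hf
  refine ge_of_tendsto (((q n).continuous.tendsto _).comp (hl f)) ?_
  exact (Eventually.filter_mono hle (eventually_ge_atTop τ)).mono fun t ht => hτ t ht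

/-- A positive idempotent strong limit point intertwines the positive part with the semigroup. -/
theorem map_posPart_of_fixed
    {P R : E →L[ℝ] E} (hPP : ∀ x, P (P x) = P x) {t : ℝ≥0}
    (hPU : ∀ x, P (U t x) = U t (P x)) (hP : ∀ x, 0 ≤ x → 0 ≤ P x)
    (hUP : ∀ x, 0 ≤ x → 0 ≤ U t (P x)) (hR : ∀ x, 0 ≤ x → 0 ≤ R x)
    (hRU : ∀ x, R (U t x) = P x) (hUR : ∀ x, U t (R x) = P x) {x : E} (hx : P x = x) :
    P (U t x)⁺ = U t (P x⁺) := by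
  have mono : ∀ L : E →L[ℝ] E, (∀ x, 0 ≤ x → 0 ≤ L x) → ∀ a b, a ≤ b → L a ≤ L b :=
    fun L hL a b hab => by simpa using hL _ (sub_nonneg.2 hab)
  apply le_antisymm
  · have h1 : (U t x)⁺ ≤ U t (P x⁺) := by
      -- `U t` alone need not be positive, so monotonicity is used only for `U t ∘ P`, which agrees
      -- with `U t` at `x`.
      refine sup_le ?_ (hUP _ (posPart_nonneg x))
      have := mono ((U t).comp P) hUP _ _ (le_posPart x)
      simpa [hx] using this
    simpa [hPU, hPP] using mono P hP _ _ h1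
  -- Conversely, `R` inverts `U t` on the range of `P`, and applying `U t ∘ P` to this inequality
  -- removes `R`.
  · have h1 : x⁺ ≤ R (U t x)⁺ := by
      refine sup_le ?_ (hR _ (posPart_nonneg _))
      simpa [hRU, hx] using mono R hR _ _ (le_posPart (U t x))
    have := mono ((U t).comp P) hUP _ _ h1
    simpa [← hPU, hUR, hPP] using this

/-- A monotone sequence with a convergent subsequence has increments that tend to zero along
that subsequence. -/
theorem tendsto_increment_of_monotone {a : ℕ → E} (ha : Monotone a) {φ : ℕ → ℕ}
    (hφ : StrictMono φ) {y : E} (h : Tendsto (a ∘ φ) atTop (𝓝 y)) :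
    Tendsto (fun k => a (φ k + 1) - a (φ k)) atTop (𝓝 0) := by
  have h1 : Tendsto (fun k => a (φ (k + 1)) - a (φ k)) atTop (𝓝 0) := by
    simpa using (h.comp (tendsto_add_atTop_nat 1)).sub h
  refine squeeze_zero_norm (fun k => ?_) (by simpa using h1.norm)
  -- Since `φ k + 1 ≤ φ (k + 1)`, the single increment is dominated by the increment between
  -- consecutive subsequence terms.
  exact Complexification.norm_le_of_nonneg_of_le (sub_nonneg.2 (ha (Nat.le_succ _)))
    (sub_le_sub_right (ha (hφ (Nat.lt_succ_self k))) _)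

/-- With `d = U t x - x`, the increments of the increasing sequence `U (n • t) x` are `U (n • t) d`.
Compactness makes them small along a subsequence, so the whole orbit of `d` tends to `0` and `d = P
d = 0`. -/
theorem eq_of_le_of_isCompact_orbit (hadd : ∀ s t x, U (s + t) x = U s (U t x)) {M : ℝ}
    (hM0 : 0 < M) (hM : ∀ t x, ‖U t x‖ ≤ M * ‖x‖)
    (hcomp : ∀ x, IsCompact (closure (Set.range fun t => U t x)))
    {P : E →L[ℝ] E} (hPmem : ⇑P ∈ strongLimitPoints U)
    (hUP : ∀ t x, 0 ≤ x → 0 ≤ U t (P x)) {x : E} (hx : P x = x) {t : ℝ≥0} (hle : x ≤ U t x) :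
    U t x = x := by
  set d := U t x - x with hd
  have hPd : P d = d := by
    rw [hd, map_sub, strongLimitPoint_comm hadd hPmem, hx]
  let a : ℕ → E := fun n => U (n • t) x
  have hinc : ∀ n, a (n + 1) - a n = U (n • t) d := fun n => by
    simp only [a, hd, map_sub, ← hadd, succ_nsmul]
  have ha : Monotone a := monotone_nat_of_le_succ fun n => by
    rw [← sub_nonneg, hinc, ← hPd]
    exact hUP _ _ (sub_nonneg.2 hle)
  obtain ⟨y, -, φ, hφ, hy⟩ := (hcomp x).tendsto_subseq (x := a) fun n => subset_closure ⟨_, rfl⟩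
  have h0 := tendsto_increment_of_monotone ha hφ hy
  simp only [hinc] at h0
  have h1 := tendsto_zero_of_frequently hadd hM0 hM h0
  obtain ⟨l, hl, hlim⟩ := mem_strongLimitPoints_iff.1 hPmem
  have : d = 0 := hPd ▸ tendsto_nhds_unique (hlim d) (h1.mono_left hl)
  exact sub_eq_zero.1 this

variable [CompleteSpace E]

/-- A real semigroup with relatively compact orbits that is strongly locally eventually positive
converges strongly. -/
theorem exists_tendsto_of_isCompact_orbit (hadd : ∀ s t x, U (s + t) x = U s (U t x))
    (hcomp : ∀ x, IsCompact (closure (Set.range fun t => U t x)))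
    (hqinf : ∀ n x y, q n (x ⊓ y) = q n x ⊓ q n y) (hqle : ∀ n x, 0 ≤ x → q n x ≤ x)
    (hqid : ∀ x, Tendsto (fun n => q n x) atTop (𝓝 x)) (F : ℕ → Submodule ℝ E)
    (hF : ∀ n x, q n x ∈ F n)
    (hLEP : ∀ n f, 0 ≤ f → f ≠ 0 → ∃ τ : ℝ≥0, ∀ t, τ ≤ t →
      IsQuasiInteriorPoint (F n) (q n (U t f))) (x : E) :
    ∃ y, Tendsto (fun t => U t x) atTop (𝓝 y) := by
  obtain ⟨M, hM0, hM⟩ := exists_norm_le_of_isCompact_orbit hcomp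
  obtain ⟨P, hPmem, hPP⟩ := exists_idempotent_strongLimitPoint hadd hcomp
  obtain ⟨P, rfl⟩ := exists_continuousLinearMap_eq hM hPmem
  replace hPP : ∀ x, P (P x) = P x := fun x => congrFun hPP x
  have hpos : ∀ S ∈ strongLimitPoints U, ∀ f, 0 ≤ f → 0 ≤ S f := fun S hS f hf => by
    refine strongLimitPoint_nonneg hqid (fun n f hf => ?_) hS hf
    rcases eq_or_ne f 0 with rfl | hne
    · exact ⟨0, fun t _ => by simp⟩
    · obtain ⟨τ, hτ⟩ := hLEP n f hf hne
      exact ⟨τ, fun t ht => (hτ t ht).2.1⟩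
  have hP := hpos P hPmem
  have hPU := strongLimitPoint_comm hadd hPmem
  have hqP : ∀ n x, 0 ≤ x → 0 ≤ q n x := fun n x hx => by
    have := hqinf n x 0
    rw [inf_eq_right.2 hx, map_zero] at this
    exact inf_eq_right.1 this.symm
  have hUP : ∀ t x, 0 ≤ x → 0 ≤ U t (P x) := fun t => by
    refine hpos (fun x => U t (P x)) ?_
    obtain ⟨l, hl, hlim⟩ := mem_strongLimitPoints_iff.1 hPmem
    refine mem_strongLimitPoints_of_tendsto (l := (l : Filter ℝ≥0)) (φ := fun s => t + s)
      (tendsto_atTop_mono (fun _ => le_add_self) (tendsto_id'.2 hl)) fun x => ?_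
    simp only [hadd]
    exact ((U t).continuous.tendsto _).comp (hlim x)
  have htotal : ∀ x, P x = x → 0 ≤ x ∨ x ≤ 0 := fun x hx => by
    have hfg : P x⁺ - P x⁻ = x := by rw [← map_sub, posPart_sub_negPart, hx]
    by_contra! hcon
    have hf : P x⁺ ≠ 0 := fun h => hcon.2 <| by
      rw [← hfg, h, zero_sub]; exact neg_nonpos.2 (hP _ (negPart_nonneg x))
    have hg : P x⁻ ≠ 0 := fun h => hcon.1 <| by
      rw [← hfg, h, sub_zero]; exact hP _ (posPart_nonneg x)
    have hzero : ∀ n z, 0 ≤ z → P (q n z) = 0 := fun n z hz => by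
      obtain ⟨τ, hτ⟩ := hLEP n _ (hP _ (posPart_nonneg x)) hf
      obtain ⟨σ, hσ⟩ := hLEP n _ (hP _ (negPart_nonneg x)) hg
      set t := max τ σ
      obtain ⟨R, hRmem, hRU⟩ := exists_strongLimitPoint_comp_eq hadd hcomp hPmem t
      obtain ⟨R, rfl⟩ := exists_continuousLinearMap_eq hM hRmem
      have hUR : ∀ x, U t (R x) = P x := fun x => by
        rw [← strongLimitPoint_comm hadd hRmem, hRU]
      -- Since `a ⊓ b = a - (a - b)⁺` and here `a - b = U t x`, the claim follows because `P (U t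
      -- x)⁺` equals `U t (P x⁺)`.
      have hinf : P (U t (P x⁺) ⊓ U t (P x⁻)) = 0 := by
        rw [inf_eq_sub_posPart_sub, ← map_sub, hfg, map_sub,
          map_posPart_of_fixed hPP (hPU t) hP (hUP t) (hpos R hRmem) hRU hUR hx, hPU, hPP,
          sub_self]
      have h0 : 0 ≤ U t (P x⁺) ⊓ U t (P x⁻) :=
        le_inf (hUP t _ (posPart_nonneg x)) (hUP t _ (negPart_nonneg x))
      refine map_eq_zero_of_isQuasiInteriorPoint (hτ t (le_max_left _ _))
        (hσ t (le_max_right _ _)) P hP ?_ (hF n z) (hqP n z hz)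
      -- `q n` preserves infima and lies below the identity on the cone, so the infimum of the two
      -- quasi-interior points is dominated by an element that `P` kills.
      rw [← hqinf]
      refine le_antisymm ?_ (hP _ (hqP n _ h0))
      simpa [hinf] using hP _ (sub_nonneg.2 (hqle n _ h0))
    refine hf (tendsto_nhds_unique ((P.continuous.tendsto _).comp (hqid x⁺)) ?_)
    exact tendsto_const_nhds.congr fun n => (hzero n _ (posPart_nonneg x)).symm
  -- The sign of the `P`-fixed vector `U t x - x` decides whether the monotonicity argument is
  -- applied to `x` or to `-x`.
  have hfix : ∀ t x, P x = x → U t x = x := fun t x hx => by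
    have hd : P (U t x - x) = U t x - x := by rw [map_sub, hPU, hx]
    have key := fun y (hy : P y = y) (h : y ≤ U t y) =>
      eq_of_le_of_isCompact_orbit hadd hM0 hM hcomp hPmem hUP hy h
    rcases htotal _ hd with h | h
    · exact key x hx (sub_nonneg.1 h)
    · have := key (-x) (by rw [map_neg, hx]) (by
        rw [map_neg]; exact neg_le_neg (sub_nonpos.1 h))
      rwa [map_neg, neg_inj] at this
  obtain ⟨l, -, hlim⟩ := mem_strongLimitPoints_iff.1 hPmem
  have hl0 : Tendsto (fun t => U t (x - P x)) l (𝓝 0) := by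
    simpa [hPP] using hlim (x - P x)
  have h0 := tendsto_zero_of_frequently hadd hM0 hM hl0
  refine ⟨P x, (zero_add (P x) ▸ h0.add_const (P x)).congr fun t => ?_⟩
  rw [map_sub, hfix t _ (hPP x), sub_add_cancel]

end Lattice

/-! ### Reduction to the real part -/

namespace Complexification

variable {E : Type*} [NormedAddCommGroup E] [NormedSpace ℝ E] [Lattice E] [IsOrderedAddMonoid E]
  [IsOrderedModule ℝ E] [HasSolidNorm E] [CompleteSpace E]

theorem ofReal_add (x y : E) : ofReal (x + y) = ofReal x + ofReal y := by
  ext <;> simp [ofReal]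

theorem ofReal_smul (c : ℝ) (x : E) : ofReal (c • x) = (c : ℂ) • ofReal x := by
  ext
  · rw [smul_re]; simp [ofReal]
  · rw [smul_im]; simp [ofReal]

theorem norm_ofReal_le (x : E) : ‖ofReal x‖ ≤ ‖x‖ := by
  simpa [ofReal] using norm_le_add (ofReal x)

theorem eq_ofReal_add_I_smul (z : Complexification E) :
    z = ofReal z.re + Complex.I • ofReal z.im := by
  ext <;> simp [ofReal]

theorem continuous_re : Continuous (re : Complexification E → E) :=
  continuous_iff_continuousAt.2 fun z => tendsto_iff_dist_tendsto_zero.2 <|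
    squeeze_zero (fun _ => dist_nonneg) (fun w => dist_re_le w z)
      (tendsto_iff_dist_tendsto_zero.1 tendsto_id)

theorem continuous_ofReal : Continuous (ofReal : E → Complexification E) :=
  continuous_iff_continuousAt.2 fun x => tendsto_iff_dist_tendsto_zero.2 <|
    squeeze_zero (fun _ => dist_nonneg)
      (fun y => (dist_le_add (ofReal y) (ofReal x)).trans (by simp [ofReal]))
      (tendsto_iff_dist_tendsto_zero.1 tendsto_id)

/-- The real part of the restriction of an operator to the real part of the space. -/
noncomputable def realPart (S : Complexification E →L[ℂ] Complexification E) : E →L[ℝ] E :=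
  LinearMap.mkContinuous
    { toFun := fun x => (S (ofReal x)).re
      map_add' := fun x y => by rw [ofReal_add, map_add, add_re]
      map_smul' := fun c x => by
        rw [ofReal_smul, map_smul, smul_re]; simp } ‖S‖ fun x =>
    (norm_re_le _).trans ((S.le_opNorm _).trans
      (mul_le_mul_of_nonneg_left (norm_ofReal_le x) (norm_nonneg S)))

theorem realPart_apply (S : Complexification E →L[ℂ] Complexification E) (x : E) :
    realPart S x = (S (ofReal x)).re := rfl

theorem ofReal_realPart {S : Complexification E →L[ℂ] Complexification E} (hS : IsRealOperator S)
    (x : E) : ofReal (realPart S x) = S (ofReal x) := by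
  ext
  · rfl
  · exact (hS x).symm

end Complexification

open Complexification in
theorem mainTheorem7 {E : Type*} [NormedAddCommGroup E] [NormedSpace ℝ E] [Lattice E]
    [IsOrderedAddMonoid E] [IsOrderedModule ℝ E] [HasSolidNorm E] [CompleteSpace E]
    (Q : ℕ → Complexification E →L[ℂ] Complexification E)
    (hQhom : ∀ n, IsLatticeHomomorphism (Q n))
    (hQinc : IsIncreasingSeq Q)
    (hQid : ConvergesStronglyToId Q)
    (T : C0Semigroup (Complexification E))
    (hTreal : T.IsReal)
    (hs : ⊥ < spectralBound T.generator)
    (hLEP : T.HasStrongLEP Q) :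
    (∀ f : Complexification E, ∃ g : Complexification E, Tendsto (fun t => T t f) atTop (𝓝 g)) ↔
      ∀ f : Complexification E, IsCompact (closure (Set.range fun t => T t f)) := by
  constructor
  · intro h f
    obtain ⟨g, hg⟩ := h f
    have hc : IsCompact (insert g (Set.range fun t => T t f)) := by
      refine Tendsto.isCompact_insert_range_of_cocompact ?_ (T.continuous_orbit' f)
      rwa [cocompact_eq_atTop]
    exact hc.closure_of_subset (Set.subset_insert _ _)
  · intro hcomp
    have hqid : ∀ x, Tendsto (fun n => realPart (Q n) x) atTop (𝓝 x) := fun x =>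
      (continuous_re.tendsto _).comp (hQid (ofReal x))
    have hreal : ∀ x : E, ∃ y, Tendsto (fun t => realPart (T t) x) atTop (𝓝 y) := by
      refine exists_tendsto_of_isCompact_orbit (q := fun n => realPart (Q n)) (fun s t x => ?_)
        (fun x => ?_) (fun n x y => ?_) (fun n x hx => ?_) hqid
        (fun n => closedSublatticeSpan (realRange (Q n))) (fun n x => ?_) fun n f hf hne => ?_
      · rw [realPart_apply, T.map_add', realPart_apply (T s), ofReal_realPart (hTreal t)]
        rfl
      · refine ((hcomp (ofReal x)).image continuous_re).closure_of_subset ?_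
        rintro _ ⟨t, rfl⟩
        exact ⟨_, subset_closure ⟨t, rfl⟩, rfl⟩
      · have h1 := (hQhom n).2 x y
        simp only [← realPart_apply] at h1
        -- Preservation of infima follows from that of suprema through `x ⊓ y + x ⊔ y = x + y`.
        have h2 := congrArg (realPart (Q n)) (inf_add_sup x y)
        rw [map_add, map_add, h1, ← inf_add_sup (realPart (Q n) x)] at h2
        exact add_right_cancel h2
      -- On the cone the operators increase to the identity, hence stay below it.
      · have hmono : Monotone fun n => realPart (Q n) x := monotone_nat_of_le_succ fun n => by
          have := (hQinc n (ofReal x) ⟨rfl, hx⟩).2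
          simpa [realPart_apply] using this
        exact hmono.ge_of_tendsto (hqid x) n
      · exact Submodule.mem_sInf.2 fun F hF => hF.2.1 ⟨x, rfl⟩
      · obtain ⟨τ, -, hτ⟩ := hLEP n (ofReal f) ⟨rfl, hf⟩ fun h => hne (congrArg re h)
        refine ⟨τ, fun t ht => ?_⟩
        rw [realPart_apply, ofReal_realPart (hTreal t)]
        exact (hτ t ht).2
    intro f
    obtain ⟨y, hy⟩ := hreal f.re
    obtain ⟨z, hz⟩ := hreal f.im
    refine ⟨ofReal y + Complex.I • ofReal z, Tendsto.congr (fun t => ?_)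
      (((continuous_ofReal.tendsto y).comp hy).add
        (((continuous_ofReal.tendsto z).comp hz).const_smul Complex.I))⟩
    conv_rhs => rw [eq_ofReal_add_I_smul f, map_add, map_smul]
    simp only [Function.comp, ofReal_realPart (hTreal t)]
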